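/- Equip $\mathbb R^n$ with its Euclidean norm. A function $F:\mathbb R^n\to[-\infty,\infty]$ is proper if it never equals $-\infty$ and $\operatorname{dom}F=\{x: F(x)<\infty\}\neq\emptyset$, and closed if it is lower semicontinuous. For proper $F$ and $x\in\operatorname{dom}F$, the regular subdifferential $\widehat\partial F(x)$ is the set of all $v\in\mathbb R^n$ with $$\liminf_{z\to x,\ z\ne x}\frac{F(z)-F(x)-\langle v,z-x\rangle}{\|z-x\|}\ge 0,$$ and the (limiting) subdifferential $\partial F(x)$ is the set of all $v$ for which there are $x^t\to x$ with $F(x^t)\to F(x)$ and $v^t\in\widehat\partial F(x^t)$ with $v^t\to v$; both are empty for $x\notin\operatorname{dom}F$. Put $\operatorname{dom}\partial F=\{x:\partial F(x)\ne\emptyset\}$ and $\operatorname{dist}(0,S)=\inf_{v\in S}\|v\|$, with $\operatorname{dist}(0,\emptyset)=\infty$. For $\alpha\in[0,1)$, a proper closed function $F$ has the Kurdyka–Łojasiewicz (KL) property with exponent $\alpha$ at $\bar x\in\operatorname{dom}\partial F$ if there are $c,\epsilon>0$ and $\nu\in(0,\infty]$ such that $$\operatorname{dist}(0,\partial F(x))\ge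 c\,(F(x)-F(\bar x))^{\alpha}\quad\text{whenever } \|x-\bar x\|\le\epsilon \text{ and } F(\bar x)<F(x)<F(\bar x)+\nu,$$ and $F$ is a KL function with exponent $\alpha$ if this holds at every $\bar x\in\operatorname{dom}\partial F$. For a set $S$, let $\delta_S$ be $0$ on $S$ and $+\infty$ elsewhere. **Theorem (KL exponent from Lagrangian relaxation).** Let $l:\mathbb R^m\to\mathbb R$ be continuous and strictly convex, $A\in\mathbb R^{m\times n}$, and $h(x)=l(Ax)$ for $x\in\mathbb R^n$. Let $g:\mathbb R^n\to\mathbb R$ be continuous and convex, $\alpha\in(0,1)$, $D\subseteq\mathbb R^n$ closed and convex, and $C=\{x\in\mathbb R^n: g(x)\le 0\}$. Suppose that 1. there exists $x_0\in D$ with $g(x_0)<0$; 2. $\inf_{x\in D}h(x)<\inf_{x\in C\cap D}h(x)$ (infima in $[-\infty,\infty]$); 3. for every $\lambda>0$, the function $h+\lambda g+\delta_D$ is a KL function with exponent $\alpha$. Then every $\bar x\in C\cap D$ belongs to $\operatorname{dom}\partial(h+\delta_C+\delta_D)$, and the proper closed function $h+\delta_C+\delta_D$ has the KL property with exponent $\alpha$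 at every $\bar x\in C\cap D$. -/

import Mathlib

open Set Filter Topology

noncomputable section

variable {E : Type*} [NormedAddCommGroup E] [InnerProductSpace ℝ E]

/-- The indicator function `δ_S` of convex analysis: `0` on `S` and `+∞` off `S`. -/
def indicatorE (S : Set E) (x : E) : EReal :=
  open Classical in if x ∈ S then 0 else ⊤

/-- A function is proper if it never takes the value `-∞` and its domain
`{x | f x < ∞}` is nonempty. -/
def IsProper (f : E → EReal) : Prop :=
  (∀ x, f x ≠ ⊥) ∧ ∃ x, f x < ⊤

/-- The regular (Fréchet) subdifferential: the vectors `v` with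
`liminf_{z → x, z ≠ x} (f z - f x - ⟪v, z - x⟫) / ‖z - x‖ ≥ 0` if `x` is in the domain of `f`,
and the empty set otherwise. -/
def regularSubdifferential (f : E → EReal) (x : E) : Set E :=
  {v | f x < ⊤ ∧
    0 ≤ liminf (fun z : E => (f z - f x - ((inner ℝ v (z - x) : ℝ) : EReal)) /
      ((‖z - x‖ : ℝ) : EReal)) (𝓝[≠] x)}

/-- The limiting subdifferential: the limits of regular subgradients `vs t` at points `xs t` with
`xs t → x` and `f (xs t) → f x` if `x` is in the domain of `f`, and the empty set otherwise. -/
def limitingSubdifferential (f : E → EReal) (x : E) : Set E :=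
  {v | f x < ⊤ ∧ ∃ (xs : ℕ → E) (vs : ℕ → E),
    Tendsto xs atTop (𝓝 x) ∧ Tendsto (fun t => f (xs t)) atTop (𝓝 (f x)) ∧
    (∀ t, vs t ∈ regularSubdifferential f (xs t)) ∧ Tendsto vs atTop (𝓝 v)}

/-- The proper closed function `f` has the Kurdyka–Łojasiewicz property at the point `a` of
`dom ∂f` with exponent `α ∈ [0, 1)`: there are `c, ε > 0` and `ν ∈ (0, ∞]` such that
`dist (0, ∂f x) ≥ c (f x - f a) ^ α` whenever `‖x - a‖ ≤ ε` and `f a < f x < f a + ν`.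
Distances are extended, so that the distance to the empty set is `∞`. The values `f a` and
`f x` are finite where their difference is converted to a real number. -/
structure HasKLExponentAt (f : E → EReal) (α : ℝ) (a : E) : Prop where
  proper : IsProper f
  closed : LowerSemicontinuous f
  exponent_nonneg : 0 ≤ α
  exponent_lt_one : α < 1
  mem_dom : (limitingSubdifferential f a).Nonempty
  bound : ∃ c : ℝ, 0 < c ∧ ∃ ε : ℝ, 0 < ε ∧ ∃ ν : EReal, 0 < ν ∧
    ∀ x : E, ‖x - a‖ ≤ ε → f a < f x → f x < f a + ν →
      ENNReal.ofReal (c * (f x - f a).toReal ^ α) ≤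
        Metric.infEDist 0 (limitingSubdifferential f x)

/-- A proper closed function is a KL function with exponent `α ∈ [0, 1)` if it has the KL property
with exponent `α` at every point of `dom ∂f`. -/
structure IsKLFunctionWithExponent (f : E → EReal) (α : ℝ) : Prop where
  proper : IsProper f
  closed : LowerSemicontinuous f
  exponent_nonneg : 0 ≤ α
  exponent_lt_one : α < 1
  kl : ∀ a : E, (limitingSubdifferential f a).Nonempty → HasKLExponentAt f α a

end

/-!
For a convex function `r` the limiting subgradients are those of convex analysis, and at a minimizer
`a` the KL property with exponent `α` is equivalent to a local Hölder error bound with exponent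
`1 - α`: one direction is the subgradient inequality, the other is Ekeland's principle applied to
`(r - r a) ^ (1 - α)`. At a point of `C ∩ D` where `h` is not minimal on `C ∩ D`, the nearby
subgradients are bounded away from `0`, which gives every exponent. At a minimizer the Slater
condition yields a Lagrange multiplier `lam`, and `lam > 0` because the constraint is active. Since
`l` is strictly convex, `A x` is the same for all minimizers `x` of `h + lam * g` over `D`, so these
minimizers all lie in `C` and minimize `h` there; as `h + lam * g ≤ h` on `C ∩ D` with equality at
`a`, the error bound of the Lagrangian is an error bound for `h` on `C ∩ D`.
-/

section Indicator

variable {X : Type*} {S : Set X} {r : X → ℝ} {x : X}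

/-- The extended-valued function `r + δ_S`, equal to `r` on `S` and to `+∞` off `S`. -/
noncomputable def addIndicator (S : Set X) (r : X → ℝ) : X → EReal :=
  fun x => (r x : EReal) + indicatorE S x

theorem addIndicator_of_mem (r : X → ℝ) (hx : x ∈ S) : addIndicator S r x = r x := by
  simp [addIndicator, indicatorE, hx]

theorem addIndicator_of_notMem (r : X → ℝ) (hx : x ∉ S) : addIndicator S r x = ⊤ := by
  simp [addIndicator, indicatorE, hx]

theorem addIndicator_lt_top_iff : addIndicator S r x < ⊤ ↔ x ∈ S := by
  by_cases hx : x ∈ S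
  · simp only [addIndicator_of_mem r hx, EReal.coe_lt_top, hx]
  · simp only [addIndicator_of_notMem r hx, lt_irrefl, hx]

theorem addIndicator_le_coe_iff {y : ℝ} : addIndicator S r x ≤ y ↔ x ∈ S ∧ r x ≤ y := by
  by_cases hx : x ∈ S
  · simp only [addIndicator_of_mem r hx, EReal.coe_le_coe_iff, hx, true_and]
  · simp only [addIndicator_of_notMem r hx, top_le_iff, EReal.coe_ne_top, hx, false_and]

theorem indicatorE_add_indicatorE (S T : Set X) (x : X) :
    indicatorE S x + indicatorE T x = indicatorE (S ∩ T) x := by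
  by_cases hS : x ∈ S <;> by_cases hT : x ∈ T <;> simp [indicatorE, hS, hT]

theorem isProper_addIndicator (r : X → ℝ) (hS : S.Nonempty) : IsProper (addIndicator S r) := by
  refine ⟨fun x => ?_, hS.imp fun x hx => addIndicator_lt_top_iff.2 hx⟩
  by_cases hx : x ∈ S
  · simp only [addIndicator_of_mem r hx, ne_eq, EReal.coe_ne_bot, not_false_eq_true]
  · simp only [addIndicator_of_notMem r hx, ne_eq, top_ne_bot, not_false_eq_true]

variable [TopologicalSpace X]

theorem lowerSemicontinuous_addIndicator (hS : IsClosed S) (hr : LowerSemicontinuousOn r S) :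
    LowerSemicontinuous (addIndicator S r) := by
  intro x y hy
  by_cases hx : x ∈ S
  · rw [addIndicator_of_mem r hx] at hy
    have hr_coe : LowerSemicontinuousOn (fun x => (r x : EReal)) S :=
      continuous_coe_real_ereal.comp_lowerSemicontinuousOn hr EReal.coe_strictMono.monotone
    filter_upwards [eventually_nhdsWithin_iff.1 (hr_coe x hx y hy)] with z hz
    by_cases hzS : z ∈ S
    · simpa only [addIndicator_of_mem r hzS] using hz hzS
    · simpa only [addIndicator_of_notMem r hzS] using hy.trans (EReal.coe_lt_top _)
  · rw [addIndicator_of_notMem r hx] at hy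
    filter_upwards [hS.isOpen_compl.mem_nhds hx] with z hz
    simpa only [addIndicator_of_notMem r hz] using hy

theorem lowerSemicontinuousOn_of_addIndicator (h : LowerSemicontinuous (addIndicator S r)) :
    LowerSemicontinuousOn r S := by
  intro x hx y hy
  have hy' : (y : EReal) < addIndicator S r x := by
    rw [addIndicator_of_mem r hx]
    exact EReal.coe_lt_coe hy
  filter_upwards [nhdsWithin_le_nhds (h x y hy'), self_mem_nhdsWithin] with z hz hzS
  rw [addIndicator_of_mem r hzS] at hz
  exact EReal.coe_lt_coe_iff.1 hz

theorem isClosed_setOf_le_of_addIndicator (h : LowerSemicontinuous (addIndicator S r))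
    {s : X → ℝ} (hs : Continuous s) : IsClosed {x | x ∈ S ∧ r x ≤ s x} := by
  have hpre : {x | x ∈ S ∧ r x ≤ s x} =
      (fun x => (x, (s x : EReal))) ⁻¹' {p | addIndicator S r p.1 ≤ p.2} := by
    ext x
    exact addIndicator_le_coe_iff.symm
  rw [hpre]
  exact h.isClosed_epigraph.preimage
    (continuous_id.prodMk (continuous_coe_real_ereal.comp hs))

end Indicator

section ConvexSeparation

theorem exists_affine_between {V : Type*} [AddCommGroup V] [Module ℝ V] [TopologicalSpace V]
    [IsTopologicalAddGroup V] [ContinuousSMul ℝ V] {S : Set V} {p q : V → ℝ}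
    (hp : ConcaveOn ℝ univ p) (hp_cont : Continuous p) (hq : ConvexOn ℝ S q) (hS : S.Nonempty)
    (hpq : ∀ w ∈ S, p w ≤ q w) :
    ∃ (φ : StrongDual ℝ V) (b : ℝ), (∀ w, p w ≤ φ w + b) ∧ ∀ w ∈ S, φ w + b ≤ q w := by
  have hypo_convex : Convex ℝ {y : V × ℝ | y.2 < p y.1} := by
    simpa only [mem_univ, true_and] using hp.convex_strict_hypograph
  have hypo_open : IsOpen {y : V × ℝ | y.2 < p y.1} := isOpen_lt (by fun_prop) (by fun_prop)
  obtain ⟨f, u, hf_lt, hf_le⟩ := geometric_hahn_banach_open hypo_convex hypo_open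
    hq.convex_epigraph <| disjoint_left.2 fun y hy hyS =>
      (hy.trans_le (hpq y.1 hyS.1)).not_ge hyS.2
  set φ : StrongDual ℝ V := f.comp (ContinuousLinearMap.inl ℝ V ℝ)
  set β : ℝ := f (0, 1)
  have hf : ∀ w t, f (w, t) = φ w + t * β := fun w t => by
    rw [← smul_eq_mul, ← map_smul]
    simp [φ, ← map_add]
  have hlow : ∀ w, ∀ t < p w, φ w + t * β < u := fun w t ht => hf w t ▸ hf_lt (w, t) ht
  have hupp : ∀ w ∈ S, u ≤ φ w + q w * β := fun w hw => hf w (q w) ▸ hf_le _ ⟨hw, le_rfl⟩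
  have hβ : 0 < β := by
    obtain ⟨z, hz⟩ := hS
    nlinarith [hlow z (p z - 1) (by linarith), hupp z hz, hpq z hz]
  have hval : ∀ w, (-(β⁻¹ • φ)) w + u / β = (u - φ w) / β := fun w => by
    simp only [neg_apply, smul_apply, smul_eq_mul]
    ring
  refine ⟨-(β⁻¹ • φ), u / β, fun w => ?_, fun w hw => ?_⟩
  · refine hval w ▸ le_of_forall_lt fun t ht => ?_
    rw [lt_div_iff₀ hβ]
    linarith [hlow w t ht]
  · rw [hval, div_le_iff₀ hβ]
    linarith [hupp w hw]

section Alternative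

variable {V ι : Type*} [AddCommGroup V] [Module ℝ V] {D : Set V} {f : ι → V → ℝ}

theorem convex_setOf_exists_forall_lt (hD : Convex ℝ D) (hf : ∀ i, ConvexOn ℝ D (f i)) :
    Convex ℝ {y : ι → ℝ | ∃ x ∈ D, ∀ i, f i x < y i} := by
  rintro y ⟨x, hx, hxy⟩ y' ⟨x', hx', hxy'⟩ a b ha hb hab
  exact ⟨a • x + b • x', hD hx hx' ha hb hab, fun i =>
    ((hf i).convex_strict_epigraph (x := (x, y i)) ⟨hx, hxy i⟩ (y := (x', y' i)) ⟨hx', hxy' i⟩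
      ha hb hab).2⟩

theorem isOpen_setOf_exists_forall_lt {Y ι : Type*} [Finite ι] (D : Set Y) (f : ι → Y → ℝ) :
    IsOpen {y : ι → ℝ | ∃ x ∈ D, ∀ i, f i x < y i} := by
  have hunion : {y : ι → ℝ | ∃ x ∈ D, ∀ i, f i x < y i} =
      ⋃ x ∈ D, univ.pi fun i => Ioi (f i x) := by
    ext y
    simp
  rw [hunion]
  exact isOpen_biUnion fun x _ => isOpen_set_pi finite_univ fun i _ => isOpen_Ioi

theorem nonpos_left_of_forall_add_mul_neg {c d : ℝ} (h : ∀ t > 0, c + t * d < 0) : c ≤ 0 := by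
  have hlim : Tendsto (fun t : ℝ => c + t * d) (𝓝[>] 0) (𝓝 c) := by
    have hcont : Continuous fun t : ℝ => c + t * d := by fun_prop
    simpa using hcont.continuousAt.tendsto.mono_left (nhdsWithin_le_nhds (a := (0 : ℝ)))
  refine le_of_tendsto hlim ?_
  filter_upwards [self_mem_nhdsWithin] with t ht using (h t ht).le

theorem nonpos_right_of_forall_add_mul_neg {c d : ℝ} (h : ∀ t > 0, c + t * d < 0) : d ≤ 0 := by
  refine nonpos_left_of_forall_add_mul_neg (d := c) fun t ht => ?_
  have hscaled := mul_neg_of_pos_of_neg ht (h t⁻¹ (inv_pos.2 ht))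
  rwa [mul_add, mul_inv_cancel_left₀ ht.ne', add_comm] at hscaled

/-- **Gordan's theorem of the alternative** for convex functions. -/
theorem exists_pos_weights_of_forall_exists_nonneg [Fintype ι] (hD : D.Nonempty)
    (hf : ∀ i, ConvexOn ℝ D (f i)) (h : ∀ x ∈ D, ∃ i, 0 ≤ f i x) :
    ∃ w : ι → ℝ, 0 < w ∧ ∀ x ∈ D, 0 ≤ ∑ i, w i * f i x := by
  classical
  obtain ⟨x₀, hx₀⟩ := hD
  obtain ⟨i₀, -⟩ := h x₀ hx₀
  obtain ⟨F, hF⟩ := geometric_hahn_banach_open_point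
    (convex_setOf_exists_forall_lt (hf i₀).1 hf) (isOpen_setOf_exists_forall_lt D f) (x := 0) <| by
      rintro ⟨x, hx, hneg⟩
      obtain ⟨i, hi⟩ := h x hx
      exact (hneg i).not_ge hi
  simp only [map_zero] at hF
  have hF_sum : ∀ y, F y = ∑ i, y i * F (Pi.single i 1) := fun y => by
    have hy : y = ∑ i, y i • Pi.single i (1 : ℝ) := by
      ext j
      simp [Pi.single_apply]
    conv_lhs => rw [hy]
    simp only [map_sum, map_smul, smul_eq_mul]
  have hF_neg : F ((f · x₀) + 1) < 0 := hF _ ⟨x₀, hx₀, fun i => by simp⟩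
  have hF_single : ∀ i, F (Pi.single i 1) ≤ 0 := fun i =>
    nonpos_right_of_forall_add_mul_neg (c := F ((f · x₀) + 1)) fun t ht => by
      have hsingle : (0 : ι → ℝ) ≤ Pi.single i 1 := Pi.single_nonneg.2 zero_le_one
      rw [← smul_eq_mul, ← map_smul, ← map_add]
      exact hF _ ⟨x₀, hx₀, fun j => by
        simpa [add_assoc] using add_pos_of_pos_of_nonneg one_pos (mul_nonneg ht.le (hsingle j))⟩
  refine ⟨fun i => -F (Pi.single i 1), lt_of_le_of_ne (fun i => neg_nonneg.2 (hF_single i)) ?_,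
    fun x hx => ?_⟩
  · intro hzero
    have hzero' : ∀ i, F (Pi.single i 1) = 0 := fun i => by simpa using (congrFun hzero i).symm
    rw [hF_sum] at hF_neg
    simp [hzero'] at hF_neg
  · have hle : F (f · x) ≤ 0 := nonpos_left_of_forall_add_mul_neg (d := F 1) fun t ht => by
      simpa using hF ((f · x) + t • 1) ⟨x, hx, fun i => by simpa using ht⟩
    rw [hF_sum] at hle
    simpa [mul_comm] using hle

end Alternative

section LagrangeMultiplier

variable {V : Type*} [AddCommGroup V] [Module ℝ V] {D : Set V} {g h : V → ℝ}

theorem exists_lagrange_multiplier {μ : ℝ} (hg : ConvexOn ℝ D g) (hh : ConvexOn ℝ D h)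
    (hslater : ∃ x ∈ D, g x < 0) (hμ : ∀ x ∈ D, g x ≤ 0 → μ ≤ h x) :
    ∃ lam : ℝ, 0 ≤ lam ∧ ∀ x ∈ D, μ ≤ h x + lam * g x := by
  obtain ⟨x₀, hx₀, hgx₀⟩ := hslater
  obtain ⟨w, hw, hle⟩ := exists_pos_weights_of_forall_exists_nonneg (D := D)
    (f := ![g, fun x => h x + -μ]) ⟨x₀, hx₀⟩ (by
      simpa only [Fin.forall_fin_two] using ⟨hg, hh.add_const (-μ)⟩) fun x hx => by
        rw [Fin.exists_fin_two]
        exact (le_or_gt 0 (g x)).imp_right fun hgx => by simpa using hμ x hx hgx.le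
  obtain ⟨hw_nonneg, hw_ne⟩ := lt_iff_le_and_ne.1 hw
  simp only [Fin.sum_univ_two, Matrix.cons_val_zero, Matrix.cons_val_one] at hle
  have hw₁ : 0 < w 1 := by
    refine lt_of_le_of_ne (hw_nonneg 1) fun hw₁ => hw_ne <| funext <| Fin.forall_fin_two.2
      ⟨(hw_nonneg 0).antisymm ?_, hw₁⟩
    have hx₀_le := hle x₀ hx₀
    simp only [Pi.zero_apply] at hw₁ ⊢
    rw [← hw₁, zero_mul, add_zero] at hx₀_le
    exact nonpos_of_mul_nonneg_left hx₀_le hgx₀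
  refine ⟨w 0 / w 1, div_nonneg (hw_nonneg 0) hw₁.le, fun x hx => ?_⟩
  have hdiv := div_nonneg (hle x hx) hw₁.le
  have hsplit : (w 0 * g x + w 1 * (h x + -μ)) / w 1 = w 0 / w 1 * g x + (h x - μ) := by
    field_simp
    ring
  linarith

theorem exists_pos_lagrange_multiplier {a : V} (hg : ConvexOn ℝ D g) (hh : ConvexOn ℝ D h)
    (hslater : ∃ x ∈ D, g x < 0) (hactive : ∃ y ∈ D, h y < h a) (ha : a ∈ D) (hga : g a ≤ 0)
    (hmin : ∀ x ∈ D, g x ≤ 0 → h a ≤ h x) :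
    ∃ lam : ℝ, 0 < lam ∧ g a = 0 ∧ IsMinOn (fun x => h x + lam * g x) D a := by
  obtain ⟨lam, hlam, hle⟩ := exists_lagrange_multiplier hg hh hslater hmin
  obtain ⟨y, hy, hya⟩ := hactive
  have hlam_pos : 0 < lam := by
    refine hlam.lt_of_ne fun hzero => hya.not_ge ?_
    simpa [← hzero] using hle y hy
  have hga_eq : g a = 0 :=
    hga.antisymm <| nonneg_of_mul_nonneg_right (by linarith [hle a ha]) hlam_pos
  exact ⟨lam, hlam_pos, hga_eq, fun x hx => by simpa [hga_eq] using hle x hx⟩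

theorem map_eq_of_isMinOn_strictConvexOn_comp_add {W : Type*} [AddCommGroup W] [Module ℝ W]
    {l : W → ℝ} {x y : V} (hl : StrictConvexOn ℝ univ l) (A : V →ₗ[ℝ] W) (hg : ConvexOn ℝ D g)
    (hx : x ∈ D) (hy : y ∈ D) (hx_min : IsMinOn (fun z => l (A z) + g z) D x)
    (hy_min : IsMinOn (fun z => l (A z) + g z) D y) : A x = A y := by
  by_contra hne
  have half_pos : (0 : ℝ) < 1 / 2 := by norm_num
  have hl_lt := hl.2 (mem_univ (A x)) (mem_univ (A y)) hne half_pos half_pos (by norm_num)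
  have hg_le := hg.2 hx hy half_pos.le half_pos.le (by norm_num)
  have hmid : (1 / 2 : ℝ) • x + (1 / 2 : ℝ) • y ∈ D :=
    hg.1 hx hy half_pos.le half_pos.le (by norm_num)
  have hx_le := hx_min hmid
  have hy_le := hy_min hmid
  simp only [mem_ofPred_eq, map_add, map_smul, smul_eq_mul] at hl_lt hg_le hx_le hy_le
  linarith

end LagrangeMultiplier

end ConvexSeparation

section Subgradient

variable {E : Type*} [NormedAddCommGroup E] [InnerProductSpace ℝ E] {S T : Set E} {r : E → ℝ}
  {x v : E}

/-- The subgradients `v` at `x`, in the sense of convex analysis, of the restriction of `r` to `S`,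
that is, of `r + δ_S`; there are none at the points off `S`. -/
def IsSubgradientOn (S : Set E) (r : E → ℝ) (x v : E) : Prop :=
  x ∈ S ∧ ∀ z ∈ S, r x + inner ℝ v (z - x) ≤ r z

theorem IsSubgradientOn.mono (hv : IsSubgradientOn T r x v) (hST : S ⊆ T) (hx : x ∈ S) :
    IsSubgradientOn S r x v :=
  ⟨hx, fun z hz => hv.2 z (hST hz)⟩

theorem isSubgradientOn_zero_of_isMinOn (hx : x ∈ S) (hmin : IsMinOn r S x) :
    IsSubgradientOn S r x 0 :=
  ⟨hx, fun z hz => by simpa using hmin hz⟩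

theorem IsSubgradientOn.sub_le_norm_mul (hv : IsSubgradientOn S r x v) {z : E} (hz : z ∈ S) :
    r x - r z ≤ ‖v‖ * ‖z - x‖ := by
  linarith [hv.2 z hz, (abs_le.1 (abs_real_inner_le_norm v (z - x))).1]

theorem IsSubgradientOn.mem_regularSubdifferential (hv : IsSubgradientOn S r x v) :
    v ∈ regularSubdifferential (addIndicator S r) x := by
  refine ⟨addIndicator_lt_top_iff.2 hv.1, le_liminf_of_le (by isBoundedDefault) ?_⟩
  refine Eventually.of_forall fun z => EReal.div_nonneg ?_ (by exact_mod_cast norm_nonneg _)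
  rw [addIndicator_of_mem r hv.1]
  by_cases hz : z ∈ S
  · rw [addIndicator_of_mem r hz]
    norm_cast
    linarith [hv.2 z hz]
  · rw [addIndicator_of_notMem r hz, EReal.top_sub_coe, EReal.top_sub_coe]
    exact le_top

theorem tendsto_add_smul_nhdsGT_nhdsNE {V : Type*} [AddCommGroup V] [Module ℝ V]
    [TopologicalSpace V] [ContinuousAdd V] [ContinuousSMul ℝ V] (x : V) {d : V} (hd : d ≠ 0) :
    Tendsto (fun t : ℝ => x + t • d) (𝓝[>] 0) (𝓝[≠] x) := by
  refine tendsto_nhdsWithin_iff.2 ⟨?_, ?_⟩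
  · have hcont : Continuous fun t : ℝ => x + t • d := by fun_prop
    simpa using hcont.continuousAt.tendsto.mono_left (nhdsWithin_le_nhds (a := (0 : ℝ)))
  · filter_upwards [self_mem_nhdsWithin] with t ht
    simpa [hd] using ht.ne'

/-- Along the segment from `x` to `z` the difference quotient of a convex function is at most its
value at `z`, so the lower limit at `x` controls it there. -/
theorem isSubgradientOn_of_mem_regularSubdifferential (hr : ConvexOn ℝ S r)
    (hv : v ∈ regularSubdifferential (addIndicator S r) x) : IsSubgradientOn S r x v := by
  obtain ⟨hx, hlim⟩ := hv
  rw [addIndicator_lt_top_iff] at hx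
  refine ⟨hx, fun z hz => ?_⟩
  rcases eq_or_ne z x with rfl | hzx
  · simp
  have hnorm : 0 < ‖z - x‖ := norm_pos_iff.2 (sub_ne_zero.2 hzx)
  by_contra! hlt
  set q : ℝ := (r z - r x - inner ℝ v (z - x)) / ‖z - x‖ with hq
  have hq_neg : (q : EReal) < 0 := by
    exact_mod_cast div_neg_of_neg_of_pos (by linarith) hnorm
  have hquot := eventually_lt_of_lt_liminf (hq_neg.trans_le hlim)
  obtain ⟨t, ht, ht₀, ht₁⟩ := (((tendsto_add_smul_nhdsGT_nhdsNE x
    (sub_ne_zero.2 hzx)).eventually hquot).and (Ioc_mem_nhdsGT (zero_lt_one' ℝ))).exists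
  have hsegment : x + t • (z - x) ∈ S := hr.1.add_smul_sub_mem hx hz ⟨ht₀.le, ht₁⟩
  have hconv : r (x + t • (z - x)) ≤ (1 - t) * r x + t * r z := by
    have hcomb : x + t • (z - x) = (1 - t) • x + t • z := by module
    simpa only [hcomb, smul_eq_mul] using
      hr.2 hx hz (sub_nonneg.2 ht₁) ht₀.le (sub_add_cancel 1 t)
  rw [addIndicator_of_mem r hx, addIndicator_of_mem r hsegment] at ht
  norm_cast at ht
  rw [add_sub_cancel_left, norm_smul, Real.norm_of_nonneg ht₀.le, inner_smul_right, hq,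
    ← EReal.coe_div, EReal.coe_lt_coe_iff, div_lt_div_iff₀ hnorm (by positivity)] at ht
  nlinarith

theorem IsSubgradientOn.mem_limitingSubdifferential (hv : IsSubgradientOn S r x v) :
    v ∈ limitingSubdifferential (addIndicator S r) x :=
  ⟨addIndicator_lt_top_iff.2 hv.1, fun _ => x, fun _ => v, tendsto_const_nhds,
    tendsto_const_nhds, fun _ => hv.mem_regularSubdifferential, tendsto_const_nhds⟩

theorem isSubgradientOn_of_mem_limitingSubdifferential (hr : ConvexOn ℝ S r)
    (hv : v ∈ limitingSubdifferential (addIndicator S r) x) : IsSubgradientOn S r x v := by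
  obtain ⟨hx, xs, vs, hxs, hrxs, hreg, hvs⟩ := hv
  rw [addIndicator_lt_top_iff] at hx
  have hsub := fun t => isSubgradientOn_of_mem_regularSubdifferential hr (hreg t)
  simp only [addIndicator_of_mem r hx, fun t => addIndicator_of_mem r (hsub t).1,
    EReal.tendsto_coe] at hrxs
  exact ⟨hx, fun z hz => le_of_tendsto (hrxs.add (hvs.inner (tendsto_const_nhds.sub hxs)))
    (Eventually.of_forall fun t => (hsub t).2 z hz)⟩

variable [CompleteSpace E]

theorem exists_isSubgradientOn_univ (hr : ConvexOn ℝ univ r) (hr_cont : Continuous r) (x : E) :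
    ∃ v, IsSubgradientOn univ r x v := by
  obtain ⟨φ, b, hlow, hupp⟩ := exists_affine_between hr.neg hr_cont.neg
    (convexOn_const (-r x) (convex_singleton x)) (singleton_nonempty x) (by simp)
  refine ⟨(InnerProductSpace.toDual ℝ E).symm (-φ), mem_univ x, fun z _ => ?_⟩
  have hlow_z := hlow z
  have hupp_x := hupp x rfl
  simp only [Pi.neg_apply] at hlow_z
  simp only [InnerProductSpace.toDual_symm_apply, neg_apply, map_sub]
  linarith

/-- The subgradient is the slope of an affine function that separates `r` from the cone
`r x - L * ‖· - x‖` below it. -/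
theorem exists_isSubgradientOn_norm_le {L : ℝ} (hr : ConvexOn ℝ S r) (hx : x ∈ S) (hL : 0 ≤ L)
    (h : ∀ w ∈ S, r x ≤ r w + L * ‖w - x‖) : ∃ v, IsSubgradientOn S r x v ∧ ‖v‖ ≤ L := by
  have hcone : ConcaveOn ℝ univ fun w => -(L * ‖w - x‖) + r x := by
    have hnorm : ConvexOn ℝ univ fun w => ‖w - x‖ := by
      simpa only [preimage_univ, Function.comp_def, ← sub_eq_add_neg] using
        (convexOn_univ_norm (E := E)).translate_left (-x)
    exact (hnorm.smul hL).neg.add_const (r x)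
  obtain ⟨φ, b, hlow, hupp⟩ := exists_affine_between hcone (by fun_prop) hr ⟨x, hx⟩
    fun w hw => by linarith [h w hw]
  have htouch : φ x + b = r x := (hupp x hx).antisymm (by simpa using hlow x)
  refine ⟨(InnerProductSpace.toDual ℝ E).symm φ, ⟨hx, fun w hw => ?_⟩, ?_⟩
  · rw [InnerProductSpace.toDual_symm_apply, map_sub]
    linarith [hupp w hw]
  · rw [LinearIsometryEquiv.norm_map]
    refine φ.opNorm_le_bound hL fun y => abs_le.2 ?_
    have hlow_add := hlow (x + y)
    have hlow_sub := hlow (x - y)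
    simp only [add_sub_cancel_left, sub_sub_cancel_left, norm_neg, map_add, map_sub]
      at hlow_add hlow_sub
    constructor <;> linarith

end Subgradient

section Ekeland

variable {X : Type*} [MetricSpace X] {φ : X → ℝ} {κ : ℝ} {x y : X}

/-- The points lying below `x` in the Ekeland order of `φ` with slope `κ`, that is, the points to
which `φ` descends from `x` at an average rate of at least `κ`. -/
def ekelandSet (φ : X → ℝ) (κ : ℝ) (x : X) : Set X :=
  {y | φ y + κ * dist y x ≤ φ x}

theorem self_mem_ekelandSet (φ : X → ℝ) (κ : ℝ) (x : X) : x ∈ ekelandSet φ κ x := by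
  simp [ekelandSet]

theorem ekelandSet_subset_of_mem (hκ : 0 ≤ κ) (hy : y ∈ ekelandSet φ κ x) :
    ekelandSet φ κ y ⊆ ekelandSet φ κ x := by
  intro w hw
  have htri := mul_le_mul_of_nonneg_left (dist_triangle w y x) hκ
  simp only [ekelandSet, mem_ofPred_eq] at hy hw ⊢
  linarith

theorem isClosed_ekelandSet (hφ : LowerSemicontinuous φ) (κ : ℝ) (x : X) :
    IsClosed (ekelandSet φ κ x) :=
  (hφ.add (by fun_prop : Continuous fun y => κ * dist y x).lowerSemicontinuous).isClosed_preimage _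

theorem exists_mem_ekelandSet_forall_dist_le (hφ : BddBelow (range φ)) (hκ : 0 < κ) {δ : ℝ}
    (hδ : 0 < δ) (x : X) :
    ∃ y ∈ ekelandSet φ κ x, ∀ w ∈ ekelandSet φ κ y, dist w y ≤ δ := by
  obtain ⟨-, ⟨y, hy, rfl⟩, hlt⟩ := Real.lt_sInf_add_pos
    ((nonempty_of_mem (self_mem_ekelandSet φ κ x)).image φ) (mul_pos hκ hδ)
  refine ⟨y, hy, fun w hw => le_of_mul_le_mul_left ?_ hκ⟩
  have hinf : sInf (φ '' ekelandSet φ κ x) ≤ φ w :=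
    csInf_le (hφ.mono (image_subset_range _ _))
      (mem_image_of_mem φ (ekelandSet_subset_of_mem hκ.le hy hw))
  have hdescent : φ w + κ * dist w y ≤ φ y := hw
  linarith

theorem exists_seq_mem_ekelandSet (hφ : BddBelow (range φ)) (hκ : 0 < κ) (x : X) :
    ∃ u : ℕ → X, u 0 ∈ ekelandSet φ κ x ∧ (∀ n, u (n + 1) ∈ ekelandSet φ κ (u n)) ∧
      ∀ n, ∀ w ∈ ekelandSet φ κ (u n), dist w (u n) ≤ 1 / ((n : ℝ) + 1) := by
  choose next hnext hdist using fun (n : ℕ) (y : X) =>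
    exists_mem_ekelandSet_forall_dist_le hφ hκ (Nat.one_div_pos_of_nat (α := ℝ) (n := n)) y
  let u : ℕ → X := fun n => Nat.rec (next 0 x) (fun k y => next (k + 1) y) n
  refine ⟨u, hnext 0 x, fun n => hnext (n + 1) (u n), fun n => ?_⟩
  cases n with
  | zero => exact hdist 0 x
  | succ k => exact hdist (k + 1) (u k)

theorem exists_ekeland_point [CompleteSpace X] (hφ : LowerSemicontinuous φ)
    (hbdd : BddBelow (range φ)) (hκ : 0 < κ) (x : X) :
    ∃ z, φ z + κ * dist z x ≤ φ x ∧ ∀ w ≠ z, φ z < φ w + κ * dist w z := by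
  obtain ⟨u, hu₀, hsucc, hdist⟩ := exists_seq_mem_ekelandSet hbdd hκ x
  have hanti : Antitone fun n => ekelandSet φ κ (u n) :=
    antitone_nat_of_succ_le fun n => ekelandSet_subset_of_mem hκ.le (hsucc n)
  have hmem : ∀ n k, n ≤ k → u k ∈ ekelandSet φ κ (u n) := fun n k hnk =>
    hanti hnk (self_mem_ekelandSet φ κ (u k))
  have hlim := tendsto_one_div_add_atTop_nhds_zero_nat (𝕜 := ℝ)
  obtain ⟨z, hz⟩ := cauchySeq_tendsto_of_complete <| cauchySeq_of_le_tendsto_0' _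
    (fun n k hnk => dist_comm (u k) (u n) ▸ hdist n _ (hmem n k hnk)) hlim
  have hz_mem : ∀ n, z ∈ ekelandSet φ κ (u n) := fun n =>
    (isClosed_ekelandSet hφ κ (u n)).mem_of_tendsto hz <|
      (eventually_ge_atTop n).mono fun k => hmem n k
  refine ⟨z, ekelandSet_subset_of_mem hκ.le hu₀ (hz_mem 0), fun w hwz => ?_⟩
  by_contra! hw
  have huw : Tendsto u atTop (𝓝 w) := tendsto_iff_dist_tendsto_zero.2 <|
    squeeze_zero (fun _ => dist_nonneg)
      (fun n => dist_comm w (u n) ▸ hdist n w (ekelandSet_subset_of_mem hκ.le (hz_mem n) hw)) hlim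
  exact hwz (tendsto_nhds_unique huw hz)

end Ekeland

section PowerDesingularization

theorem rpow_le_rpow_add_mul_sub {s t β : ℝ} (hs : 0 < s) (ht : 0 ≤ t) (hβ₀ : 0 ≤ β)
    (hβ₁ : β ≤ 1) : t ^ β ≤ s ^ β + β * s ^ (β - 1) * (t - s) := by
  have hbernoulli := rpow_one_add_le_one_add_mul_self (s := t / s - 1)
    (by linarith [div_nonneg ht hs.le]) hβ₀ hβ₁
  rw [add_sub_cancel, Real.div_rpow ht hs.le, div_le_iff₀ (Real.rpow_pos_of_pos hs β)]
    at hbernoulli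
  refine hbernoulli.trans_eq ?_
  rw [Real.rpow_sub_one hs.ne']
  field_simp

theorem le_add_of_rpow_one_sub_le {s t d α : ℝ} (hs : 0 < s) (ht : 0 ≤ t) (hα₀ : 0 ≤ α)
    (hα₁ : α < 1) (h : s ^ (1 - α) ≤ t ^ (1 - α) + d) : s ≤ t + d / (1 - α) * s ^ α := by
  have hβ : 0 < 1 - α := sub_pos.2 hα₁
  have htangent := rpow_le_rpow_add_mul_sub hs ht hβ.le (sub_le_self 1 hα₀)
  rw [sub_sub_cancel_left, Real.rpow_neg hs.le] at htangent
  have hslope : (1 - α) * (s ^ α)⁻¹ * (s - t) ≤ d := by linarith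
  have hsα := Real.rpow_pos_of_pos hs α
  have hgap : s - t ≤ d / (1 - α) * s ^ α := by
    rw [div_mul_eq_mul_div, le_div_iff₀ hβ, ← div_le_iff₀ hsα]
    exact (by ring : (s - t) * (1 - α) / s ^ α = (1 - α) * (s ^ α)⁻¹ * (s - t)).trans_le hslope
  linarith

variable {X : Type*} [MetricSpace X] [CompleteSpace X] {S : Set X} {r : X → ℝ} {κ : ℝ} {a x : X}

/-- Ekeland's principle is applied on the sublevel set of `x` alone, which is closed even where
`S` is not. -/
theorem exists_ekeland_point_comp {ψ : ℝ → ℝ} (hr : LowerSemicontinuous (addIndicator S r))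
    (hψ : Monotone ψ) (hψ_cont : Continuous ψ) (hbdd : BddBelow (r '' S)) (hκ : 0 < κ)
    (hx : x ∈ S) : ∃ z ∈ S, ψ (r z) + κ * dist z x ≤ ψ (r x) ∧
      ∀ w ∈ S, ψ (r z) ≤ ψ (r w) + κ * dist w z := by
  let T : Set X := {y | y ∈ S ∧ r y ≤ r x}
  have hT : IsClosed T := isClosed_setOf_le_of_addIndicator hr continuous_const
  have := hT.completeSpace_coe
  have hlsc : LowerSemicontinuous fun y : T => ψ (r y) :=
    hψ_cont.comp_lowerSemicontinuous (lowerSemicontinuous_restrict_iff.2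
      ((lowerSemicontinuousOn_of_addIndicator hr).mono fun y hy => hy.1)) hψ
  obtain ⟨m, hm⟩ := hbdd
  have hlow : BddBelow (range fun y : T => ψ (r y)) :=
    ⟨ψ m, forall_mem_range.2 fun y => hψ (hm (mem_image_of_mem r y.2.1))⟩
  obtain ⟨⟨z, hzS, hzx⟩, hdescent, hslope⟩ := exists_ekeland_point hlsc hlow hκ ⟨x, hx, le_rfl⟩
  refine ⟨z, hzS, hdescent, fun w hwS => ?_⟩
  rcases le_or_gt (r w) (r x) with hwx | hxw
  · rcases eq_or_ne w z with rfl | hwz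
    · simp
    · exact (hslope ⟨w, hwS, hwx⟩ (by simpa using hwz)).le
  · linarith [hψ (hzx.trans hxw.le), mul_nonneg hκ.le (dist_nonneg (x := w) (y := z))]

theorem exists_ekeland_point_rpow_sub {β : ℝ} (hr : LowerSemicontinuous (addIndicator S r))
    (hβ : 0 ≤ β) (hmin : IsMinOn r S a) (hκ : 0 < κ) (hx : x ∈ S) :
    ∃ z ∈ S, (r z - r a) ^ β + κ * dist z x ≤ (r x - r a) ^ β ∧
      ∀ w ∈ S, (r z - r a) ^ β ≤ (r w - r a) ^ β + κ * dist w z := by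
  have hψ : Monotone fun t : ℝ => (max (t - r a) 0) ^ β := fun s t hst =>
    Real.rpow_le_rpow (le_max_right _ _) (max_le_max_right 0 (sub_le_sub_right hst _)) hβ
  have hψ_cont : Continuous fun t : ℝ => (max (t - r a) 0) ^ β :=
    (Real.continuous_rpow_const hβ).comp (by fun_prop)
  have hψ_eq : ∀ y ∈ S, max (r y - r a) 0 = r y - r a := fun y hy =>
    max_eq_left (sub_nonneg.2 (hmin hy))
  obtain ⟨z, hz, hdescent, hslope⟩ := exists_ekeland_point_comp hr hψ hψ_cont
    ⟨r a, forall_mem_image.2 fun y hy => hmin hy⟩ hκ hx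
  simp only [hψ_eq z hz, hψ_eq x hx] at hdescent hslope
  exact ⟨z, hz, hdescent, fun w hw => hψ_eq w hw ▸ hslope w hw⟩

end PowerDesingularization

section ErrorBound

variable {X : Type*} [PseudoMetricSpace X] {S T : Set X} {r h : X → ℝ} {β : ℝ} {a : X}

/-- A local Hölder error bound at `a`: the power `β` of the excess `r x - r a` bounds the distance
of `x` to the sublevel set `{p ∈ S | r p ≤ r a}`. The bound is expressed by a point `p` of the
sublevel set within that distance, so that no infimum has to be attained. -/
def HasErrorBoundAt (S : Set X) (r : X → ℝ) (β : ℝ) (a : X) : Prop :=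
  ∃ κ > 0, ∃ ε > 0, ∃ ν > 0, ∀ x ∈ S, dist x a ≤ ε → r x < r a + ν →
    ∃ p ∈ S, r p ≤ r a ∧ κ * dist x p ≤ (r x - r a) ^ β

theorem HasErrorBoundAt.of_le_on_subset (heb : HasErrorBoundAt T r β a) (hβ : 0 ≤ β)
    (hmin : IsMinOn r T a) (hST : S ⊆ T) (hle : ∀ x ∈ S, r x ≤ h x) (heq : r a = h a)
    (hlevel : ∀ p ∈ T, r p ≤ r a → p ∈ S ∧ h p ≤ h a) : HasErrorBoundAt S h β a := by
  obtain ⟨κ, hκ, ε, hε, ν, hν, hbound⟩ := heb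
  refine ⟨κ, hκ, ε, hε, ν, hν, fun x hx hxa hlt => ?_⟩
  obtain ⟨p, hp, hpa, hxp⟩ := hbound x (hST hx) hxa (by linarith [hle x hx])
  refine ⟨p, (hlevel p hp hpa).1, (hlevel p hp hpa).2, hxp.trans ?_⟩
  exact Real.rpow_le_rpow (sub_nonneg.2 (hmin (hST hx))) (by linarith [hle x hx]) hβ

end ErrorBound

section KurdykaLojasiewicz

variable {E : Type*} [NormedAddCommGroup E] [InnerProductSpace ℝ E] {S : Set E} {r : E → ℝ}
  {α : ℝ} {a : E}

/-- The Kurdyka–Łojasiewicz inequality at `a` with exponent `α` for `r + δ_S`, in terms of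
subgradients in the sense of convex analysis. -/
def KLInequalityAt (S : Set E) (r : E → ℝ) (α : ℝ) (a : E) : Prop :=
  ∃ c > 0, ∃ ε > 0, ∃ ν > 0, ∀ x v, IsSubgradientOn S r x v → ‖x - a‖ ≤ ε → r a < r x →
    r x < r a + ν → c * (r x - r a) ^ α ≤ ‖v‖

theorem ofReal_le_infEDist_zero_iff {V : Type*} [SeminormedAddCommGroup V] {s : Set V} {c : ℝ} :
    ENNReal.ofReal c ≤ Metric.infEDist 0 s ↔ ∀ v ∈ s, c ≤ ‖v‖ := by
  simp [Metric.le_infEDist]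

theorem HasKLExponentAt.klInequalityAt (hkl : HasKLExponentAt (addIndicator S r) α a)
    (ha : a ∈ S) : KLInequalityAt S r α a := by
  obtain ⟨c, hc, ε, hε, ν, hν, hbound⟩ := hkl.bound
  obtain ⟨ν', hν', hνν'⟩ := EReal.lt_iff_exists_real_btwn.1 hν
  refine ⟨c, hc, ε, hε, ν', by exact_mod_cast hν', fun x v hv hxa hlt hlt' => ?_⟩
  have hlt_add : (r x : EReal) < r a + ν :=
    (by exact_mod_cast hlt' : (r x : EReal) < r a + ν').trans_le (add_le_add_right hνν'.le _)
  have hbound_x := hbound x hxa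
  simp only [addIndicator_of_mem r hv.1, addIndicator_of_mem r ha] at hbound_x
  exact ofReal_le_infEDist_zero_iff.1 (hbound_x (by exact_mod_cast hlt) hlt_add) v
    hv.mem_limitingSubdifferential

theorem KLInequalityAt.hasKLExponentAt (hkl : KLInequalityAt S r α a) (hr : ConvexOn ℝ S r)
    (hlsc : LowerSemicontinuous (addIndicator S r)) (hα₀ : 0 ≤ α) (hα₁ : α < 1)
    (hsub : ∃ v, IsSubgradientOn S r a v) : HasKLExponentAt (addIndicator S r) α a where
  proper := isProper_addIndicator r (hsub.elim fun _ hv => ⟨a, hv.1⟩)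
  closed := hlsc
  exponent_nonneg := hα₀
  exponent_lt_one := hα₁
  mem_dom := hsub.imp fun _ hv => hv.mem_limitingSubdifferential
  bound := by
    obtain ⟨c, hc, ε, hε, ν, hν, hbound⟩ := hkl
    obtain ⟨-, ha, -⟩ := hsub
    refine ⟨c, hc, ε, hε, ν, by exact_mod_cast hν, fun x hxa hlt hlt' => ?_⟩
    rw [addIndicator_of_mem r ha] at hlt hlt' ⊢
    have hx : x ∈ S := addIndicator_lt_top_iff.1 (hlt'.trans (by exact_mod_cast EReal.coe_lt_top _))
    rw [addIndicator_of_mem r hx] at hlt hlt' ⊢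
    exact ofReal_le_infEDist_zero_iff.2 fun v hv =>
      hbound x v (isSubgradientOn_of_mem_limitingSubdifferential hr hv) hxa
        (by exact_mod_cast hlt) (by exact_mod_cast hlt')

/-- Near `a` the values of `r` stay above `r y` by a fixed amount, so subgradients are bounded away
from `0`. -/
theorem klInequalityAt_of_lt {y : E} (hα : 0 ≤ α) (hy : y ∈ S) (hya : r y < r a) :
    KLInequalityAt S r α a := by
  have hden : 0 < 1 + ‖y - a‖ := by positivity
  refine ⟨(r a - r y) / (1 + ‖y - a‖), div_pos (sub_pos.2 hya) hden, 1, one_pos, 1, one_pos,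
    fun x v hv hxa hlt hlt' => ?_⟩
  have hpow : (r x - r a) ^ α ≤ 1 :=
    Real.rpow_le_one (sub_nonneg.2 hlt.le) (by linarith) hα
  have hdist : ‖y - x‖ ≤ 1 + ‖y - a‖ := by
    linarith [norm_sub_le_norm_sub_add_norm_sub y a x, norm_sub_rev a x]
  calc (r a - r y) / (1 + ‖y - a‖) * (r x - r a) ^ α ≤ (r a - r y) / (1 + ‖y - a‖) :=
        mul_le_of_le_one_right (div_nonneg (sub_nonneg.2 hya.le) hden.le) hpow
    _ ≤ ‖v‖ := by
        rw [div_le_iff₀ hden]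
        linarith [hv.sub_le_norm_mul hy, mul_le_mul_of_nonneg_left hdist (norm_nonneg v)]

theorem HasErrorBoundAt.klInequalityAt (heb : HasErrorBoundAt S r (1 - α) a) :
    KLInequalityAt S r α a := by
  obtain ⟨κ, hκ, ε, hε, ν, hν, hbound⟩ := heb
  refine ⟨κ, hκ, ε, hε, ν, hν, fun x v hv hxa hlt hlt' => ?_⟩
  obtain ⟨p, hp, hpa, hxp⟩ := hbound x hv.1 (dist_eq_norm x a ▸ hxa) hlt'
  have hgap : 0 < r x - r a := sub_pos.2 hlt
  have hgap_le : r x - r a ≤ ‖v‖ * ‖x - p‖ := by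
    rw [norm_sub_rev]
    linarith [hv.sub_le_norm_mul hp]
  rw [dist_eq_norm] at hxp
  refine le_of_mul_le_mul_right ?_ hgap
  calc κ * (r x - r a) ^ α * (r x - r a)
      ≤ κ * (r x - r a) ^ α * (‖v‖ * ‖x - p‖) := by gcongr
    _ = (r x - r a) ^ α * ‖v‖ * (κ * ‖x - p‖) := by ring
    _ ≤ (r x - r a) ^ α * ‖v‖ * (r x - r a) ^ (1 - α) := by gcongr
    _ = ‖v‖ * (r x - r a) := by
        rw [mul_right_comm, ← Real.rpow_add hgap, add_sub_cancel, Real.rpow_one, mul_comm]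

variable [CompleteSpace E]

theorem exists_isSubgradientOn_norm_le_of_rpow_sub_le {m κ : ℝ} {z : E} (hr : ConvexOn ℝ S r)
    (hα₀ : 0 ≤ α) (hα₁ : α < 1) (hm : ∀ w ∈ S, m ≤ r w) (hκ : 0 ≤ κ) (hz : z ∈ S) (hmz : m < r z)
    (hslope : ∀ w ∈ S, (r z - m) ^ (1 - α) ≤ (r w - m) ^ (1 - α) + κ * ‖w - z‖) :
    ∃ v, IsSubgradientOn S r z v ∧ ‖v‖ ≤ κ / (1 - α) * (r z - m) ^ α := by
  have hgap : 0 < r z - m := sub_pos.2 hmz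
  have hβ : 0 < 1 - α := sub_pos.2 hα₁
  refine exists_isSubgradientOn_norm_le hr hz
    (mul_nonneg (div_nonneg hκ hβ.le) (Real.rpow_nonneg hgap.le α)) fun w hw => ?_
  have hle := le_add_of_rpow_one_sub_le hgap (sub_nonneg.2 (hm w hw)) hα₀ hα₁ (hslope w hw)
  have hcomm : κ * ‖w - z‖ / (1 - α) * (r z - m) ^ α = κ / (1 - α) * (r z - m) ^ α * ‖w - z‖ := by
    ring
  linarith

/-- If `x` were too far from the minimizers, an Ekeland point of `(r - r a) ^ (1 - α)` started at
`x` would not reach them either, and its small subgradient would contradict the KL inequality. -/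
theorem HasKLExponentAt.hasErrorBoundAt (hkl : HasKLExponentAt (addIndicator S r) α a)
    (hr : ConvexOn ℝ S r) (ha : a ∈ S) (hmin : IsMinOn r S a) :
    HasErrorBoundAt S r (1 - α) a := by
  obtain ⟨c, hc, ε, hε, ν, hν, hbound⟩ := hkl.klInequalityAt ha
  have hβ : 0 < 1 - α := sub_pos.2 hkl.exponent_lt_one
  have hκ : 0 < c / 2 * (1 - α) := by positivity
  refine ⟨c / 2 * (1 - α), hκ, ε / 2, half_pos hε, ν, hν, fun x hx hxa hlt => ?_⟩
  by_contra! hfar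
  simp only [dist_eq_norm] at hxa hfar
  obtain ⟨z, hz, hdescent, hslope⟩ := exists_ekeland_point_rpow_sub hkl.closed hβ.le hmin hκ hx
  simp only [dist_eq_norm] at hdescent hslope
  have hpow_nonneg : 0 ≤ (r z - r a) ^ (1 - α) := Real.rpow_nonneg (sub_nonneg.2 (hmin hz)) _
  have haz : r a < r z := by
    by_contra! hza
    have hfar_z := hfar z hz hza
    rw [norm_sub_rev] at hfar_z
    linarith
  have hzx : ‖z - x‖ < ‖x - a‖ :=
    lt_of_mul_lt_mul_left (by linarith [hfar a ha le_rfl]) hκ.le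
  have hza_le : ‖z - a‖ ≤ ε := by linarith [norm_sub_le_norm_sub_add_norm_sub z x a]
  have hrzx : r z - r a ≤ r x - r a :=
    (Real.rpow_le_rpow_iff (sub_nonneg.2 (hmin hz)) (sub_nonneg.2 (hmin hx)) hβ).1 <| by
      linarith [mul_nonneg hκ.le (norm_nonneg (z - x))]
  obtain ⟨v, hv, hv_norm⟩ := exists_isSubgradientOn_norm_le_of_rpow_sub_le hr
    hkl.exponent_nonneg hkl.exponent_lt_one (fun w hw => hmin hw) hκ.le hz haz hslope
  rw [mul_div_cancel_right₀ _ hβ.ne'] at hv_norm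
  linarith [hbound z v hv hza_le haz (by linarith),
    mul_pos hc (Real.rpow_pos_of_pos (sub_pos.2 haz) α)]

end KurdykaLojasiewicz
section LagrangianRelaxation

variable {E F : Type*} [NormedAddCommGroup E] [InnerProductSpace ℝ E] [CompleteSpace E]
  [AddCommGroup F] [Module ℝ F] {l : F → ℝ} {D : Set E} {g : E → ℝ} {α : ℝ}

/-- At a constrained minimizer `a` pass to the Lagrangian `h + lam * g`, where `h = l ∘ A`. Its
minimizers over `D` share the value `A a` by strict convexity, hence the value of `h`, hence that of
`g`: they are feasible, and the error bound of the Lagrangian is one for the constrained problem. -/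
theorem hasErrorBoundAt_of_lagrangian_kl (hl : StrictConvexOn ℝ univ l) (A : E →ₗ[ℝ] F)
    (hg : ConvexOn ℝ D g) (h_slater : ∃ x₀ ∈ D, g x₀ < 0)
    (h_lagrange : ∀ lam : ℝ, 0 < lam →
      IsKLFunctionWithExponent (addIndicator D fun x => l (A x) + lam * g x) α)
    {a : E} (h_active : ∃ y ∈ D, l (A y) < l (A a)) (ha : a ∈ D) (hga : g a ≤ 0)
    (hmin : ∀ x ∈ D, g x ≤ 0 → l (A a) ≤ l (A x)) :
    HasErrorBoundAt ({x | g x ≤ 0} ∩ D) (fun x => l (A x)) (1 - α) a := by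
  have hh : ConvexOn ℝ D fun x => l (A x) :=
    (hl.convexOn.comp_linearMap A).subset (subset_univ D) hg.1
  obtain ⟨lam, hlam, hga_zero, hmin_lagrange⟩ :=
    exists_pos_lagrange_multiplier hg hh h_slater h_active ha hga hmin
  have hlam_g : ConvexOn ℝ D fun x => lam * g x := hg.smul hlam.le
  have hkl := h_lagrange lam hlam
  have hsub := (isSubgradientOn_zero_of_isMinOn ha hmin_lagrange).mem_limitingSubdifferential
  refine ((hkl.kl a ⟨0, hsub⟩).hasErrorBoundAt (hh.add hlam_g) ha hmin_lagrange).of_le_on_subset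
    (sub_nonneg.2 hkl.exponent_lt_one.le) hmin_lagrange inter_subset_right (fun x hx => ?_)
    (by simp [hga_zero]) fun p hp hpa => ?_
  · linarith [mul_nonpos_of_nonneg_of_nonpos hlam.le hx.1]
  · have hA : A p = A a := map_eq_of_isMinOn_strictConvexOn_comp_add hl A hlam_g hp ha
      (fun x hx => hpa.trans (hmin_lagrange hx)) hmin_lagrange
    have hgp : lam * g p ≤ 0 := by simpa [hA, hga_zero] using hpa
    exact ⟨⟨nonpos_of_mul_nonpos_right hgp hlam, hp⟩, by rw [hA]⟩

theorem mainTheorem8_general (hl : StrictConvexOn ℝ univ l) (A : E →ₗ[ℝ] F)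
    (hh : Continuous fun x => l (A x)) (hg : ConvexOn ℝ D g) (h_slater : ∃ x₀ ∈ D, g x₀ < 0)
    (h_active : (⨅ x ∈ D, (l (A x) : EReal)) < ⨅ x ∈ {x | g x ≤ 0} ∩ D, (l (A x) : EReal))
    (h_lagrange : ∀ lam : ℝ, 0 < lam → IsKLFunctionWithExponent
      (fun x => ((l (A x) + lam * g x : ℝ) : EReal) + indicatorE D x) α) :
    ∀ a ∈ {x | g x ≤ 0} ∩ D, HasKLExponentAt
      (fun x => (l (A x) : EReal) + indicatorE {x | g x ≤ 0} x + indicatorE D x) α a := by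
  intro a ha
  simp only [add_assoc, indicatorE_add_indicatorE]
  have hkl := h_lagrange 1 one_pos
  have hconv : ConvexOn ℝ univ fun x => l (A x) := hl.convexOn.comp_linearMap A
  have hC_convex : Convex ℝ ({x | g x ≤ 0} ∩ D) := by
    rw [inter_comm]
    exact hg.convex_le 0
  have hC_closed : IsClosed ({x | g x ≤ 0} ∩ D) := by
    simpa [inter_def, and_comm] using isClosed_setOf_le_of_addIndicator hkl.closed hh
  obtain ⟨v, hv⟩ := exists_isSubgradientOn_univ hconv hh a
  refine KLInequalityAt.hasKLExponentAt ?_ (hconv.subset (subset_univ _) hC_convex)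
    (lowerSemicontinuous_addIndicator hC_closed (hh.lowerSemicontinuous.lowerSemicontinuousOn _))
    hkl.exponent_nonneg hkl.exponent_lt_one ⟨v, hv.mono (subset_univ _) ha⟩
  by_cases hmin : ∀ x ∈ D, g x ≤ 0 → l (A a) ≤ l (A x)
  · have hactive_a : ∃ y ∈ D, l (A y) < l (A a) := by
      simpa [iInf_lt_iff] using h_active.trans_le (iInf₂_le a ha)
    exact (hasErrorBoundAt_of_lagrangian_kl hl A hg h_slater h_lagrange hactive_a ha.2 ha.1
      hmin).klInequalityAt
  · push Not at hmin
    obtain ⟨y, hyD, hgy, hya⟩ := hmin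
    exact klInequalityAt_of_lt hkl.exponent_nonneg ⟨hgy, hyD⟩ hya

end LagrangianRelaxation

theorem mainTheorem8 (m n : ℕ)
    (l : EuclideanSpace ℝ (Fin m) → ℝ) (hl_cont : Continuous l)
    (hl_conv : StrictConvexOn ℝ Set.univ l)
    (A : Matrix (Fin m) (Fin n) ℝ)
    (h : EuclideanSpace ℝ (Fin n) → ℝ) (hh : ∀ x, h x = l (WithLp.toLp 2 (A.mulVec x.ofLp)))
    (g : EuclideanSpace ℝ (Fin n) → ℝ) (hg_cont : Continuous g)
    (hg_conv : ConvexOn ℝ Set.univ g)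
    (α : ℝ) (hα₀ : 0 < α) (hα₁ : α < 1)
    (D : Set (EuclideanSpace ℝ (Fin n))) (hD_closed : IsClosed D) (hD_conv : Convex ℝ D)
    (C : Set (EuclideanSpace ℝ (Fin n))) (hC : C = {x | g x ≤ 0})
    (h_slater : ∃ x₀ ∈ D, g x₀ < 0)
    (h_active : (⨅ x ∈ D, (h x : EReal)) < ⨅ x ∈ C ∩ D, (h x : EReal))
    (h_lagrange : ∀ lam : ℝ, 0 < lam →
      IsKLFunctionWithExponent (fun x => ((h x + lam * g x : ℝ) : EReal) + indicatorE D x) α) :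
    ∀ a ∈ C ∩ D,
      HasKLExponentAt (fun x => (h x : EReal) + indicatorE C x + indicatorE D x) α a := by
  obtain rfl : h = fun x => l (Matrix.toLpLin 2 2 A x) := funext hh
  subst hC
  exact mainTheorem8_general hl_conv (Matrix.toLpLin 2 2 A)
    (hl_cont.comp (LinearMap.continuous_of_finiteDimensional _))
    (hg_conv.subset (subset_univ D) hD_conv) h_slater h_active h_lagrange
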